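/- Let $0\le\varepsilon<1/2$. There is a constant $c>0$, depending only on $\varepsilon$, such that for all integers $0\le b<a\le n$, with $g=a-b$, the following holds. Every quantum query algorithm that is given oracle access to the bits of two strings $x,y\in\{0,1\}^n$ (through the unitary that sends $|i,c,w\rangle$ to $|i,c\oplus z_i,w\rangle$, where $z=(x,y)$ is the concatenated $2n$-bit input) and that decides with error probability at most $\varepsilon$ whether the Hamming distance $h(x,y)$ satisfies $h(x,y)\ge a$ or $h(x,y)\le b$, under the promise that one of the two holds, makes at least $c\sqrt{n/g}$ oracle queries. That is, the bounded-error quantum query complexity of this problem is $\Omega(\sqrt{n/g})$. -/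

import Mathlib

/-- Basis states `|i, c, w⟩` of a query algorithm whose input bits are indexed by `ι`: a query-index
register `i`, a one-qubit answer register `c`, and a workspace register `w`. -/
abbrev QBasis (ι W : Type) : Type := ι × Bool × W

/-- The (finite-dimensional) Hilbert space spanned by the basis states `|i, c, w⟩`. -/
abbrev QState (ι W : Type) [Fintype ι] [Fintype W] : Type := EuclideanSpace ℂ (QBasis ι W)

/-- The permutation `(i, c, w) ↦ (i, c ⊕ z_i, w)` of the basis states. -/
def queryPerm {ι W : Type} (z : ι → Bool) : Equiv.Perm (QBasis ι W) where
  toFun s := (s.1, Bool.xor s.2.1 (z s.1), s.2.2)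
  invFun s := (s.1, Bool.xor s.2.1 (z s.1), s.2.2)
  left_inv s := by simp
  right_inv s := by simp

/-- The quantum oracle of the input `z`: the unitary operator with
`O_z |i, c, w⟩ = |i, c ⊕ z_i, w⟩`. -/
noncomputable def queryOracle {ι W : Type} [Fintype ι] [Fintype W] (z : ι → Bool) :
    QState ι W ≃ₗᵢ[ℂ] QState ι W :=
  LinearIsometryEquiv.piLpCongrLeft 2 ℂ ℂ (queryPerm z)

/-- A quantum query algorithm on inputs whose bits are indexed by `ι`. The workspace is an arbitrary
finite register; the initial state, the unitary operators and the final measurement do not depend on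
the input. -/
structure QuantumQueryAlgorithm (ι : Type) [Fintype ι] where
  /-- basis states of the workspace -/
  W : Type
  [fintypeW : Fintype W]
  /-- the number of oracle queries -/
  queries : ℕ
  /-- the initial state -/
  init : QState ι W
  norm_init : ‖init‖ = 1
  /-- the unitary operators between queries (only those with index at most `queries` are used) -/
  U : ℕ → (QState ι W ≃ₗᵢ[ℂ] QState ι W)
  /-- the outcomes of the final measurement in the standard basis on which the algorithm accepts -/
  accept : Set (QBasis ι W)

namespace QuantumQueryAlgorithm

variable {ι : Type} [Fintype ι]

attribute [instance] QuantumQueryAlgorithm.fintypeW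

/-- The state `U_t O_z U_{t-1} O_z ⋯ O_z U_0 |init⟩` on input `z` after `t` queries. -/
noncomputable def state (A : QuantumQueryAlgorithm ι) (z : ι → Bool) : ℕ → QState ι A.W
  | 0 => A.U 0 A.init
  | t + 1 => A.U (t + 1) (queryOracle z (A.state z t))

open Classical in
/-- The probability that the algorithm accepts (outputs 1) on input `z`. -/
noncomputable def acceptProb (A : QuantumQueryAlgorithm ι) (z : ι → Bool) : ℝ :=
  ∑ s : QBasis ι A.W, if s ∈ A.accept then ‖A.state z A.queries s‖ ^ 2 else 0

end QuantumQueryAlgorithm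

/-- The algorithm, which queries the bits of a pair `(x, y)` of `n`-bit strings (`Sum.inl i` is the
position of `x_i`, `Sum.inr i` that of `y_i`), decides with error probability at most `ε` whether
`h(x, y) ≥ a` (accept) or `h(x, y) ≤ b` (reject), under the promise that one of the two holds. -/
def DecidesGapHamming {n : ℕ} (A : QuantumQueryAlgorithm (Fin n ⊕ Fin n)) (a b : ℕ) (ε : ℝ) : Prop :=
  ∀ x y : Fin n → Bool,
    (a ≤ hammingDist x y → 1 - ε ≤ A.acceptProb (Sum.elim x y)) ∧
    (hammingDist x y ≤ b → A.acceptProb (Sum.elim x y) ≤ ε)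

/-! With `y = 0` the distance is the weight of `x`. From a base string of weight `b` or `a`,
flipping any one of `K ≥ n/(4g)` disjoint blocks of `g` positions crosses the promise gap, so it
must shift the acceptance probability by `1 - 2ε`. Each of the `T` queries of the base run has unit
mass to share among the blocks, and Cauchy–Schwarz over time gives `K(1 - 2ε)² ≤ 16T²`
(`QuantumQueryAlgorithm.hybrid_bound`). The blocks come from
`DecidesGapHamming.exists_blocks_bound`. -/

/-- The squared mass that a state puts on the queries at which two inputs differ. -/
noncomputable def diffWeight {ι W : Type} [Fintype ι] [Fintype W] (z z' : ι → Bool)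
    (ψ : QState ι W) : ℝ :=
  ∑ s : QBasis ι W, if z' s.1 ≠ z s.1 then ‖ψ s‖ ^ 2 else 0

theorem diffWeight_nonneg {ι W : Type} [Fintype ι] [Fintype W] (z z' : ι → Bool)
    (ψ : QState ι W) : 0 ≤ diffWeight z z' ψ :=
  Finset.sum_nonneg fun s _ => by split_ifs <;> positivity

theorem queryOracle_apply {ι W : Type} [Fintype ι] [Fintype W] (z : ι → Bool) (ψ : QState ι W)
    (s : QBasis ι W) : queryOracle z ψ s = ψ (queryPerm z s) := rfl

theorem diffWeight_comp_queryPerm {ι W : Type} [Fintype ι] [Fintype W] (z z' u : ι → Bool)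
    (ψ : QState ι W) :
    (∑ s : QBasis ι W, if z' s.1 ≠ z s.1 then ‖ψ (queryPerm u s)‖ ^ 2 else 0) =
      diffWeight z z' ψ :=
  Equiv.sum_comp (queryPerm u)
    (fun s : QBasis ι W => if z' s.1 ≠ z s.1 then ‖ψ s‖ ^ 2 else 0)

/-- The oracles agree wherever the inputs do, and a query preserves the index register, hence the
mass on the differing positions. -/
theorem norm_queryOracle_sub_le {ι W : Type} [Fintype ι] [Fintype W] (z z' : ι → Bool)
    (ψ : QState ι W) :
    ‖queryOracle z' ψ - queryOracle z ψ‖ ≤ 2 * √(diffWeight z z' ψ) := by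
  have key : ‖queryOracle z' ψ - queryOracle z ψ‖ ^ 2 ≤ 4 * diffWeight z z' ψ := by
    rw [EuclideanSpace.norm_sq_eq]
    calc ∑ s, ‖(queryOracle z' ψ - queryOracle z ψ) s‖ ^ 2
        ≤ ∑ s : QBasis ι W, (2 * (if z' s.1 ≠ z s.1 then ‖ψ (queryPerm z' s)‖ ^ 2 else 0) +
            2 * (if z' s.1 ≠ z s.1 then ‖ψ (queryPerm z s)‖ ^ 2 else 0)) := by
          refine Finset.sum_le_sum fun s _ => ?_
          rw [PiLp.sub_apply, queryOracle_apply, queryOracle_apply]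
          by_cases h : z' s.1 = z s.1
          · have : queryPerm z' s = queryPerm z s := by simp [queryPerm, h]
            simp [this, h]
          · simp only [ne_eq, h, not_false_eq_true, if_true]
            have h1 := norm_sub_le (ψ (queryPerm z' s)) (ψ (queryPerm z s))
            have h2 := pow_le_pow_left₀ (norm_nonneg _) h1 2
            nlinarith [sq_nonneg (‖ψ (queryPerm z' s)‖ - ‖ψ (queryPerm z s)‖)]
      _ = 4 * diffWeight z z' ψ := by
          rw [Finset.sum_add_distrib, ← Finset.mul_sum, ← Finset.mul_sum,
            diffWeight_comp_queryPerm, diffWeight_comp_queryPerm]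
          ring
  refine abs_le_of_sq_le_sq' ?_ (by positivity) |>.2
  rw [mul_pow, Real.sq_sqrt (diffWeight_nonneg z z' ψ)]
  linarith

/-- A basis state queries one position, which lies in at most one of the disjoint difference sets.
-/
theorem sum_diffWeight_le {ι W κ : Type} [Fintype ι] [Fintype W] [Fintype κ] (z : ι → Bool)
    (z' : κ → ι → Bool) (hz : ∀ i j k, z' j i ≠ z i → z' k i ≠ z i → j = k) (ψ : QState ι W) :
    ∑ j, diffWeight z (z' j) ψ ≤ ‖ψ‖ ^ 2 := by
  classical
  unfold diffWeight
  rw [EuclideanSpace.norm_sq_eq, Finset.sum_comm]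
  refine Finset.sum_le_sum fun s _ => ?_
  rw [← Finset.sum_filter, Finset.sum_const, nsmul_eq_mul]
  have hcard : (Finset.univ.filter fun j => z' j s.1 ≠ z s.1).card ≤ 1 :=
    Finset.card_le_one.2 fun j hj k hk =>
      hz s.1 j k (Finset.mem_filter.1 hj).2 (Finset.mem_filter.1 hk).2
  exact mul_le_of_le_one_left (by positivity) (by exact_mod_cast hcard)

namespace QuantumQueryAlgorithm

variable {ι : Type} [Fintype ι]

theorem norm_state (A : QuantumQueryAlgorithm ι) (z : ι → Bool) (t : ℕ) : ‖A.state z t‖ = 1 := by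
  induction t with
  | zero => simp [state, A.norm_init]
  | succ t ih => simp [state, ih]

/-- Unitaries preserve the error accumulated so far; each query adds only the oracles' discrepancy
on the run on `z`. -/
theorem norm_state_sub_le (A : QuantumQueryAlgorithm ι) (z z' : ι → Bool) (t : ℕ) :
    ‖A.state z' t - A.state z t‖ ≤
      ∑ r ∈ Finset.range t, 2 * √(diffWeight z z' (A.state z r)) := by
  induction t with
  | zero => simp [state]
  | succ t ih =>
    rw [Finset.sum_range_succ]
    have hsplit : queryOracle z' (A.state z' t) - queryOracle z (A.state z t) =
        queryOracle z' (A.state z' t - A.state z t) +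
          (queryOracle z' (A.state z t) - queryOracle z (A.state z t)) := by
      rw [map_sub]; abel
    calc ‖A.state z' (t + 1) - A.state z (t + 1)‖
        = ‖queryOracle z' (A.state z' t) - queryOracle z (A.state z t)‖ := by
          rw [state, state, ← map_sub, LinearIsometryEquiv.norm_map]
      _ ≤ ‖A.state z' t - A.state z t‖ +
            ‖queryOracle z' (A.state z t) - queryOracle z (A.state z t)‖ := by
          rw [hsplit]
          exact (norm_add_le _ _).trans_eq (by rw [LinearIsometryEquiv.norm_map])
      _ ≤ _ := add_le_add ih (norm_queryOracle_sub_le z z' _)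

theorem abs_acceptProb_sub_le (A : QuantumQueryAlgorithm ι) (z z' : ι → Bool) :
    |A.acceptProb z' - A.acceptProb z| ≤ 2 * ‖A.state z' A.queries - A.state z A.queries‖ := by
  classical
  set φ := A.state z' A.queries with hφ
  set ψ := A.state z A.queries with hψ
  have hcs (χ : QState ι A.W) (hχ : ‖χ‖ = 1) : ∑ s, ‖(φ - ψ) s‖ * ‖χ s‖ ≤ ‖φ - ψ‖ := by
    have := Real.sum_mul_le_sqrt_mul_sqrt Finset.univ (fun s => ‖(φ - ψ) s‖) (fun s => ‖χ s‖)
    rwa [← EuclideanSpace.norm_eq, ← EuclideanSpace.norm_eq, hχ, mul_one] at this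
  calc |A.acceptProb z' - A.acceptProb z|
      ≤ ∑ s, (‖(φ - ψ) s‖ * ‖φ s‖ + ‖(φ - ψ) s‖ * ‖ψ s‖) := by
        unfold acceptProb
        rw [← Finset.sum_sub_distrib]
        refine (Finset.abs_sum_le_sum_abs _ _).trans (Finset.sum_le_sum fun s _ => ?_)
        rw [← hφ, ← hψ]
        split_ifs
        -- `|p² - q²| = |p - q|(p + q)`; Cauchy–Schwarz against the unit vectors `φ` and `ψ` then
        -- bounds the sum.
        · rw [sq_sub_sq, abs_mul, abs_of_nonneg (by positivity : 0 ≤ ‖φ s‖ + ‖ψ s‖), ← mul_add,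
            mul_comm]
          exact mul_le_mul_of_nonneg_right (abs_norm_sub_norm_le _ _) (by positivity)
        · simp only [sub_zero, abs_zero]; positivity
    _ ≤ 2 * ‖φ - ψ‖ := by
        rw [Finset.sum_add_distrib]
        linarith [hcs φ (A.norm_state z' _), hcs ψ (A.norm_state z _)]

/-- The hybrid argument: an algorithm that distinguishes an input from every one of several inputs
which differ from it on pairwise disjoint sets of positions makes many queries. -/
theorem hybrid_bound (A : QuantumQueryAlgorithm ι) {κ : Type} [Fintype κ] (z : ι → Bool)
    (z' : κ → ι → Bool) (hz : ∀ i j k, z' j i ≠ z i → z' k i ≠ z i → j = k) {δ : ℝ} (hδ : 0 ≤ δ)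
    (hacc : ∀ j, δ ≤ |A.acceptProb (z' j) - A.acceptProb z|) :
    δ * √(Fintype.card κ) ≤ 4 * A.queries := by
  have hj (j : κ) : δ ^ 2 ≤
      16 * (A.queries * ∑ r ∈ Finset.range A.queries, diffWeight z (z' j) (A.state z r)) := by
    have h1 : δ ≤ 4 * ∑ r ∈ Finset.range A.queries, √(diffWeight z (z' j) (A.state z r)) := by
      have h2 := A.norm_state_sub_le z (z' j) A.queries
      rw [← Finset.mul_sum] at h2
      linarith [hacc j, A.abs_acceptProb_sub_le z (z' j)]
    have h3 := sq_sum_le_card_mul_sum_sq (s := Finset.range A.queries)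
      (f := fun r => √(diffWeight z (z' j) (A.state z r)))
    simp only [Real.sq_sqrt (diffWeight_nonneg _ _ _), Finset.card_range] at h3
    calc δ ^ 2 ≤ _ := pow_le_pow_left₀ hδ h1 2
      _ ≤ _ := by rw [mul_pow]; linarith
  have hsum : (Fintype.card κ : ℝ) * δ ^ 2 ≤ 16 * (A.queries : ℝ) ^ 2 := by
    calc (Fintype.card κ : ℝ) * δ ^ 2 = ∑ _j : κ, δ ^ 2 := by simp
      _ ≤ _ := Finset.sum_le_sum fun j _ => hj j
      _ = 16 * (A.queries *
            ∑ r ∈ Finset.range A.queries, ∑ j, diffWeight z (z' j) (A.state z r)) := by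
          rw [← Finset.mul_sum, ← Finset.mul_sum, Finset.sum_comm]
      _ ≤ 16 * (A.queries * ∑ r ∈ Finset.range A.queries, (1 : ℝ)) := by
          gcongr with r
          simpa [A.norm_state z r] using sum_diffWeight_le z z' hz (A.state z r)
      _ = _ := by simp; ring
  refine abs_le_of_sq_le_sq' ?_ (by positivity) |>.2
  rw [mul_pow, mul_pow, Real.sq_sqrt (by positivity)]
  linarith

end QuantumQueryAlgorithm

theorem hammingDist_indicator {n : ℕ} (S : Finset ℕ) (hS : S ⊆ Finset.range n) :
    hammingDist (fun i : Fin n => decide (i.val ∈ S)) (fun _ => false) = S.card := by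
  unfold hammingDist
  refine Finset.card_bij (fun i _ => i.val) (fun i hi => by simpa using hi)
    (fun i _ j _ h => Fin.ext h) fun k hk => ?_
  exact ⟨⟨k, Finset.mem_range.1 (hS hk)⟩, by simpa using hk, rfl⟩

theorem DecidesGapHamming.hybrid_bound {n a b : ℕ} {ε : ℝ} (hε : ε < 1 / 2)
    {A : QuantumQueryAlgorithm (Fin n ⊕ Fin n)} (hA : DecidesGapHamming A a b ε) {K : ℕ}
    (S₀ : Finset ℕ) (S : Fin K → Finset ℕ) (hS₀ : S₀ ⊆ Finset.range n)
    (hS : ∀ j, S j ⊆ Finset.range n)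
    (hdisj : ∀ i j k, ¬(i ∈ S j ↔ i ∈ S₀) → ¬(i ∈ S k ↔ i ∈ S₀) → j = k)
    (hcard : (S₀.card ≤ b ∧ ∀ j, a ≤ (S j).card) ∨ (a ≤ S₀.card ∧ ∀ j, (S j).card ≤ b)) :
    (1 - 2 * ε) * √K ≤ 4 * A.queries := by
  let z (T : Finset ℕ) : Fin n ⊕ Fin n → Bool :=
    Sum.elim (fun i => decide (i.val ∈ T)) (fun _ => false)
  have hacc (T : Finset ℕ) (hT : T ⊆ Finset.range n) :
      (a ≤ T.card → 1 - ε ≤ A.acceptProb (z T)) ∧ (T.card ≤ b → A.acceptProb (z T) ≤ ε) := by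
    have := hA (fun i => decide (i.val ∈ T)) (fun _ => false)
    rwa [hammingDist_indicator T hT] at this
  have := A.hybrid_bound (z S₀) (fun j => z (S j)) (δ := 1 - 2 * ε) ?_ (by linarith) ?_
  · simpa using this
  · rintro (i | i) j k hj hk
    · exact hdisj i j k (by simpa [z] using hj) (by simpa [z] using hk)
    · simp [z] at hj
  · intro j
    rcases hcard with ⟨h₀, h⟩ | ⟨h₀, h⟩
    · rw [le_abs]; left
      linarith [(hacc S₀ hS₀).2 h₀, (hacc (S j) (hS j)).1 (h j)]
    · rw [le_abs]; right
      linarith [(hacc S₀ hS₀).1 h₀, (hacc (S j) (hS j)).2 (h j)]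

/-- The `j`-th block of length `g` after position `s`. -/
def block (s g j : ℕ) : Finset ℕ := Finset.Ico (s + j * g) (s + j * g + g)

theorem card_block (s g j : ℕ) : (block s g j).card = g := by simp [block]

theorem block_subset_range {s g j K m : ℕ} (hj : j < K) (hm : s + K * g ≤ m) :
    block s g j ⊆ Finset.range m := by
  intro i hi
  rw [block, Finset.mem_Ico] at hi
  have : (j + 1) * g ≤ K * g := Nat.mul_le_mul_right g hj
  rw [Finset.mem_range]
  linarith [hi.2]

theorem eq_of_mem_block {s g j k i : ℕ} (hj : i ∈ block s g j) (hk : i ∈ block s g k) :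
    j = k := by
  rw [block, Finset.mem_Ico] at hj hk
  by_contra hne
  rcases Nat.lt_or_gt_of_ne hne with h | h
  · have : (j + 1) * g ≤ k * g := Nat.mul_le_mul_right g h
    linarith [hj.2, hk.1]
  · have : (k + 1) * g ≤ j * g := Nat.mul_le_mul_right g h
    linarith [hk.2, hj.1]

theorem disjoint_range_block (s g j : ℕ) : Disjoint (Finset.range s) (block s g j) := by
  rw [Finset.disjoint_left]
  intro i hi hb
  rw [block, Finset.mem_Ico] at hb
  rw [Finset.mem_range] at hi
  have : 0 ≤ j * g := Nat.zero_le _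
  omega

/-- One factor 2 pays for the floor, as `m / g ≥ 1`, the other for `m ≥ n / 2`. -/
theorem div_le_four_mul_div {n m g : ℕ} (hg : 0 < g) (hgm : g ≤ m) (hm : n ≤ 2 * m) :
    (n : ℝ) / g ≤ 4 * (m / g : ℕ) := by
  have h1 : 1 ≤ m / g := (Nat.one_le_div_iff hg).2 hgm
  have h2 : m < g * (m / g + 1) := Nat.lt_mul_div_succ m hg
  have h3 : n ≤ 4 * (m / g) * g := by nlinarith
  rw [div_le_iff₀ (by exact_mod_cast hg)]
  exact_mod_cast h3

/-- There are at least `n / (4 g)` disjoint blocks of `g` positions, each of which leads from one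
side of the promise to the other when it is flipped. -/
theorem DecidesGapHamming.exists_blocks_bound {n a b : ℕ} {ε : ℝ} (hε : ε < 1 / 2)
    {A : QuantumQueryAlgorithm (Fin n ⊕ Fin n)} (hA : DecidesGapHamming A a b ε) (hba : b < a)
    (han : a ≤ n) :
    ∃ K : ℕ, (n : ℝ) / (a - b : ℕ) ≤ 4 * K ∧ (1 - 2 * ε) * √K ≤ 4 * A.queries := by
  obtain ⟨g, hg, rfl⟩ : ∃ g, 0 < g ∧ a = b + g := ⟨a - b, by omega, by omega⟩
  rw [Nat.add_sub_cancel_left]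
  -- Either the `n - b` zeros of a weight-`b` string fill at least half the positions, and blocks of
  -- zeros are set; or `b ≥ n / 2`, and blocks of ones are cleared from a weight-`a` string.
  rcases le_total n (2 * (n - b)) with h | h
  · have hK : b + (n - b) / g * g ≤ n := by
      have := Nat.div_mul_le_self (n - b) g
      omega
    refine ⟨(n - b) / g, div_le_four_mul_div hg (by omega) h,
      hA.hybrid_bound hε (Finset.range b) (fun j => Finset.range b ∪ block b g j)
        (Finset.range_subset_range.2 (by omega)) (fun j => ?_) (fun i j k hj hk => ?_)
        (Or.inl ⟨by simp, fun j => ?_⟩)⟩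
    · exact Finset.union_subset (Finset.range_subset_range.2 (by omega))
        (block_subset_range j.2 hK)
    · rw [Finset.mem_union] at hj hk
      exact Fin.ext (eq_of_mem_block (i := i) (s := b) (g := g) (by tauto) (by tauto))
    · rw [Finset.card_union_of_disjoint (disjoint_range_block b g j), card_block,
        Finset.card_range]
  · have hK : 0 + (b + g) / g * g ≤ b + g := by
      have := Nat.div_mul_le_self (b + g) g
      omega
    refine ⟨(b + g) / g, div_le_four_mul_div hg (by omega) (by omega),
      hA.hybrid_bound hε (Finset.range (b + g)) (fun j => Finset.range (b + g) \ block 0 g j)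
        (Finset.range_subset_range.2 han) (fun j => ?_) (fun i j k hj hk => ?_)
        (Or.inr ⟨by simp, fun j => ?_⟩)⟩
    · exact Finset.sdiff_subset.trans (Finset.range_subset_range.2 han)
    · rw [Finset.mem_sdiff] at hj hk
      exact Fin.ext (eq_of_mem_block (i := i) (s := 0) (g := g) (by tauto) (by tauto))
    · rw [Finset.card_sdiff_of_subset (block_subset_range j.2 hK), card_block, Finset.card_range,
        Nat.add_sub_cancel]

theorem theorem1 (ε : ℝ) (hε₀ : 0 ≤ ε) (hε : ε < 1 / 2) :
    ∃ c : ℝ, 0 < c ∧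
      ∀ n a b : ℕ, b < a → a ≤ n →
        ∀ A : QuantumQueryAlgorithm (Fin n ⊕ Fin n), DecidesGapHamming A a b ε →
          c * Real.sqrt ((n : ℝ) / ((a : ℝ) - (b : ℝ))) ≤ (A.queries : ℝ) := by
  -- The 8 is the 4 of the hybrid bound times `√4` from `n/g ≤ 4K`.
  refine ⟨(1 - 2 * ε) / 8, by linarith, fun n a b hba han A hA => ?_⟩
  obtain ⟨K, hK, hbound⟩ := hA.exists_blocks_bound hε hba han
  rw [Nat.cast_sub hba.le] at hK
  have hsqrt : √((n : ℝ) / ((a : ℝ) - b)) ≤ 2 * √K := by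
    refine (Real.sqrt_le_sqrt hK).trans_eq ?_
    rw [Real.sqrt_mul (by norm_num), show (4 : ℝ) = 2 ^ 2 by norm_num,
      Real.sqrt_sq (by norm_num)]
  have := mul_le_mul_of_nonneg_left hsqrt (by linarith : 0 ≤ (1 - 2 * ε) / 8)
  linarith
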